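/- Let $M,N\ge 1$ be integers. For a vector or column $v$ let $s(v)$ denote the sum of its entries. On a probability space consider random vectors $C_0\in\mathbb{R}^N$ and, for $n\ge 1$, $1\le i\le M$, random vectors $\chi_n^{(i)}\in\mathbb{R}^N$ (indicating the colour of the $i$-th ball drawn in step $n$) and random replacement matrices $R_n^{(i)}\in\mathbb{R}^{N\times N}$. Let the urn composition evolve by $$C_{n+1}=C_n+\sum_{i=1}^M R_{n+1}^{(i)}\chi_{n+1}^{(i)}\qquad(n\ge 0),$$ and let $\mathcal{G}_n$ be the $\sigma$-algebra generated by $C_0$ and by $\chi_j^{(i)},R_j^{(i)}$ for $1\le j\le n$, $1\le i\le M$. (Ball numbers are allowed to be non-negative reals; integer-valued compositions $C_n\in\mathbb{N}^N$ are included.) Assume, for all $n\ge1$, with all (in)equalities between random variables holding almost surely: (U1) $C_0$ has non-negative coordinates and at least one positive coordinate. (U2) $\mathbb{P}(\chi_n^{(i)}=e_j\mid\mathcal{G}_{n-1})=C_{n-1,j}/s(C_{n-1})$ for all $1\le i\le M$, $1\le j\le N$, where $e_j$ is the $j$-th unit vector. (U3) Given $\mathcal{G}_{n-1}$, the vectors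 $\chi_n^{(1)},\dots,\chi_n^{(M)}$ are identically distributed, the matrices $R_n^{(1)},\dots,R_n^{(M)}$ are identically distributed, and $\chi_n^{(1)},\dots,\chi_n^{(M)},R_n^{(1)},\dots,R_n^{(M)}$ are conditionally independent. (U4) All entries of $R_n^{(i)}$ are non-negative, for all $i$. (U5) There is a constant $\gamma_1$, independent of $n,i,j$, such that the $j$-th column of $R_n^{(i)}$ has sum $\gamma_1$ for all $i,j$. (U6) There is a constant $\gamma_2$, independent of $n,j$, such that every column of the generating matrix $H_n=\mathbb{E}(R_n^{(1)}\mid\mathcal{G}_{n-1})$ has sum $\gamma_2$. (U7) There is a deterministic irreducible non-negative $N\times N$ matrix $H$ such that $H_n\to H$ almost surely as $n\to\infty$. (Irreducible: for all $k,l$ there is $p\ge 1$ with $(H^p)_{k,l}>0$.) Then there is a unique vector $v_H^*\in\mathbb{R}^N$ with $s(v_H^*)=1$ that is an eigenvector of $H$ for the eigenvalue of $H$ with the largest real part (which is real), and $$\frac{C_n}{s(C_n)}\longrightarrow v_H^*\qquad\text{almost surely as } n\to\infty.$$ -/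

import Mathlib

open MeasureTheory ProbabilityTheory Filter
open scoped Topology Matrix

namespace UrnModel

/-- Matrices carry the product σ-algebra of their entries. -/
instance matrixMeasurableSpace {N : ℕ} : MeasurableSpace (Matrix (Fin N) (Fin N) ℝ) :=
  inferInstanceAs (MeasurableSpace (Fin N → Fin N → ℝ))

/-- The weight `s(v)` of a vector: the sum of its coordinates. -/
def weight {N : ℕ} (v : Fin N → ℝ) : ℝ := ∑ j, v j

/-- The σ-algebra `𝒢 n` generated by the initial composition `C₀` and by the draws `χ j i` and
the replacement matrices `R j i` of the steps `j = 1, …, n` (all trials `i`). -/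
@[reducible] def history {Ω : Type*} {N M : ℕ} (C₀ : Ω → Fin N → ℝ)
    (χ : ℕ → Fin M → Ω → Fin N → ℝ) (R : ℕ → Fin M → Ω → Matrix (Fin N) (Fin N) ℝ)
    (n : ℕ) : MeasurableSpace Ω :=
  MeasurableSpace.comap C₀ inferInstance ⊔
    ⨆ j ∈ Finset.Icc 1 n, ⨆ i : Fin M,
      (MeasurableSpace.comap (χ j i) inferInstance ⊔ MeasurableSpace.comap (R j i) inferInstance)

/-- The σ-algebras `m k` are (jointly) conditionally independent given `G` under `μ`:
for every finite subfamily and every choice of events `f k ∈ m k`, the conditional probability of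
the intersection is almost surely the product of the conditional probabilities.
On standard Borel spaces this is the characterization of `ProbabilityTheory.iCondIndep`; it is
spelled out here so that the probability space can be arbitrary. -/
def CondIndepGiven {Ω ι : Type*} [MeasurableSpace Ω] (μ : Measure Ω) (G : MeasurableSpace Ω)
    (m : ι → MeasurableSpace Ω) : Prop :=
  ∀ (s : Finset ι) (f : ι → Set Ω), (∀ k ∈ s, MeasurableSet[m k] (f k)) →
    μ⟦⋂ k ∈ s, f k | G⟧ =ᵐ[μ] ∏ k ∈ s, μ⟦f k | G⟧

/-- The random elements `X k` are identically distributed given `G` under `μ`. -/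
def CondIdentDistribGiven {Ω ι E : Type*} [MeasurableSpace Ω] [MeasurableSpace E] (μ : Measure Ω)
    (G : MeasurableSpace Ω) (X : ι → Ω → E) : Prop :=
  ∀ k l : ι, ∀ A : Set E, MeasurableSet A → μ⟦X k ⁻¹' A | G⟧ =ᵐ[μ] μ⟦X l ⁻¹' A | G⟧

/-- The entrywise conditional expectation of a random matrix given `G`. -/
noncomputable def condExpMatrix {Ω : Type*} [MeasurableSpace Ω] {N : ℕ} (μ : Measure Ω)
    (G : MeasurableSpace Ω) (A : Ω → Matrix (Fin N) (Fin N) ℝ) (ω : Ω) :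
    Matrix (Fin N) (Fin N) ℝ :=
  Matrix.of fun k l => (μ[fun ω' => A ω' k l | G]) ω

/-- `v` is an eigenvector of `H`, of weight one, for the eigenvalue of `H` with the largest real
part among all complex eigenvalues (and this eigenvalue is real). -/
def IsNormalizedLeadingEigenvector {N : ℕ} (H : Matrix (Fin N) (Fin N) ℝ) (v : Fin N → ℝ) :
    Prop :=
  weight v = 1 ∧
    ∃ ρ : ℝ, H *ᵥ v = ρ • v ∧ ∀ z ∈ spectrum ℂ (H.map (fun x : ℝ => (x : ℂ))), z.re ≤ ρ

end UrnModel

/-!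
The column sums of the replacement matrices are all `γ`, so the generating matrices and their limit
`H` have column sums `γ` as well, and `γ > 0` because `H` is irreducible. Hence `P = γ⁻¹ H` is an
irreducible column-stochastic matrix. Taking weights in `H v = ρ v` shows that a weight-one
eigenvector with real eigenvalue belongs to `ρ = γ`, and `γ` bounds the real parts of the spectrum;
the leading eigenvectors of weight one are therefore the weight-one fixed vectors of `P`.

The main tool is a contraction (`exists_contracting_seminorm`). Some power `m` of the lazy matrix
`Q = (1 + P) / 2` is entrywise positive, so by Dobrushin's estimate it contracts the `ℓ¹`-norm on
vectors of weight zero. Then `Q` itself contracts `V y = ∑_{k < m} ‖Q ^ k y‖₁` there, and so does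
every Euler step `y ↦ y + a (P y - y)` with `0 ≤ a ≤ 1 / 2`, by a factor `1 - c a`. This gives
existence and uniqueness of the fixed vector `v`.

For the urn, a nonempty urn almost surely draws unit vectors, so that `s(C n) = s(C 0) + n M γ`
(`ae_composition_and_draws`). Conditional independence and the common conditional law of the
replacement matrices give the increment of step `n + 1` the conditional mean `M H_n X_n`, where
`X_n = C n / s(C n)` (`condExp_sum_drawnColumn`). Consequently
`X_{n+1} = X_n + a_n (P X_n - X_n + δ_n) + ξ_n / s(C (n + 1))` with `a_n = γ M / s(C (n + 1))`,
`δ_n = γ⁻¹ (H_n - H) X_n → 0` and centered bounded noise `ξ_n`. The noise series is a martingale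
bounded in `L²`, because `s(C (n + 1))` grows linearly and is known at time zero, so it converges
almost surely (`ae_exists_tendsto_sum_noise`). Adding its tail to `X_n - v` leaves a recursion with
vanishing perturbations, and the contraction together with `∑ a_n = ∞` forces convergence to zero
(`tendsto_of_stochastic_approximation`). No bound on the speed of `H_n → H` is needed.
-/

namespace UrnModel

/-! ### Contraction by irreducible stochastic matrices -/

section Contraction

variable {ι : Type*} [Fintype ι]

lemma sum_mulVec (A : Matrix ι ι ℝ) (y : ι → ℝ) :
    ∑ i, (A *ᵥ y) i = ∑ j, (∑ i, A i j) * y j := by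
  simp only [Matrix.mulVec, dotProduct, Finset.sum_mul]
  exact Finset.sum_comm

lemma sum_abs_mulVec_le {A : Matrix ι ι ℝ} (hA : ∀ i j, 0 ≤ A i j) {c : ℝ}
    (hc : ∀ j, ∑ i, A i j = c) (y : ι → ℝ) :
    ∑ i, |(A *ᵥ y) i| ≤ c * ∑ j, |y j| := by
  calc ∑ i, |(A *ᵥ y) i| ≤ ∑ i, (A *ᵥ fun j => |y j|) i := by
        refine Finset.sum_le_sum fun i _ => ?_
        refine (Finset.abs_sum_le_sum_abs _ _).trans (le_of_eq ?_)
        exact Finset.sum_congr rfl fun j _ => by rw [abs_mul, abs_of_nonneg (hA i j)]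
    _ = c * ∑ j, |y j| := by rw [sum_mulVec, Finset.mul_sum]; simp only [hc]

/-- Dobrushin's contraction estimate: subtracting the constant `η` from every entry of `B` does
not change its action on vectors of weight zero. -/
lemma sum_abs_mulVec_le_of_le {B : Matrix ι ι ℝ} {η : ℝ} (hη : ∀ i j, η ≤ B i j)
    (hB : ∀ j, ∑ i, B i j = 1) {y : ι → ℝ} (hy : ∑ j, y j = 0) :
    ∑ i, |(B *ᵥ y) i| ≤ (1 - Fintype.card ι * η) * ∑ j, |y j| := by
  have h : B *ᵥ y = (Matrix.of fun i j => B i j - η) *ᵥ y := by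
    ext i
    simp [Matrix.mulVec, dotProduct, sub_mul, ← Finset.mul_sum, hy]
  rw [h]
  refine sum_abs_mulVec_le (fun i j => by simpa using hη i j) (fun j => ?_) y
  simp [hB]

variable [DecidableEq ι]

lemma sum_abs_mulVec_le_of_mem_colStochastic {B : Matrix ι ι ℝ}
    (hB : B ∈ Matrix.colStochastic ℝ ι) (y : ι → ℝ) : ∑ i, |(B *ᵥ y) i| ≤ ∑ j, |y j| := by
  simpa using sum_abs_mulVec_le (fun i j => Matrix.nonneg_of_mem_colStochastic hB)
    (Matrix.sum_col_of_mem_colStochastic hB) y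

/-- The lazy version `(1 + P) / 2` of a stochastic matrix `P`. -/
noncomputable def lazy (P : Matrix ι ι ℝ) : Matrix ι ι ℝ := (2⁻¹ : ℝ) • (1 + P)

lemma lazy_mulVec (P : Matrix ι ι ℝ) (y : ι → ℝ) :
    lazy P *ᵥ y = (2⁻¹ : ℝ) • (y + P *ᵥ y) := by
  rw [lazy, Matrix.smul_mulVec, Matrix.add_mulVec, Matrix.one_mulVec]

lemma lazy_mem_colStochastic {P : Matrix ι ι ℝ} (hP : P ∈ Matrix.colStochastic ℝ ι) :
    lazy P ∈ Matrix.colStochastic ℝ ι := by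
  have h := Matrix.convex_colStochastic (R := ℝ) (n := ι) (one_mem _) hP
    (a := 2⁻¹) (b := 2⁻¹) (by norm_num) (by norm_num) (by norm_num)
  simpa [lazy, smul_add] using h

/-- Expanding `(1 + P) ^ k`, the term `P ^ k` bounds the nonnegative sum from below. -/
lemma pow_le_lazy_pow {P : Matrix ι ι ℝ} (hP : ∀ i j, 0 ≤ P i j) (k : ℕ) (i j : ι) :
    0 ≤ (P ^ k) i j ∧ (2⁻¹ : ℝ) ^ k * (P ^ k) i j ≤ (lazy P ^ k) i j := by
  induction k generalizing i j with
  | zero => by_cases h : i = j <;> simp [h]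
  | succ k ih =>
    simp only [pow_succ, Matrix.mul_apply]
    refine ⟨Finset.sum_nonneg fun l _ => mul_nonneg (ih i l).1 (hP l j), ?_⟩
    rw [Finset.mul_sum]
    refine Finset.sum_le_sum fun l _ => ?_
    have h1 : 2⁻¹ * P l j ≤ lazy P l j := by
      have : (0 : ℝ) ≤ (1 : Matrix ι ι ℝ) l j := by
        rw [Matrix.one_apply]; split_ifs <;> norm_num
      simp only [lazy, Matrix.smul_apply, Matrix.add_apply, smul_eq_mul]
      linarith
    calc (2⁻¹ : ℝ) ^ k * 2⁻¹ * ((P ^ k) i l * P l j)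
        = ((2⁻¹ : ℝ) ^ k * (P ^ k) i l) * (2⁻¹ * P l j) := by ring
      _ ≤ _ := mul_le_mul (ih i l).2 h1 (mul_nonneg (by norm_num) (hP l j))
          ((mul_nonneg (by positivity) (ih i l).1).trans (ih i l).2)

/-- Some power of the lazy version of an irreducible stochastic matrix is entrywise positive:
laziness makes the positivity of an entry persist in all higher powers. -/
lemma exists_lazy_pow_pos {P : Matrix ι ι ℝ} (hP : P ∈ Matrix.colStochastic ℝ ι)
    (hirr : P.IsIrreducible) : ∃ m, ∀ i j, 0 < (lazy P ^ m) i j := by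
  have hnn := hirr.nonneg
  have hstep : ∀ k i j, 0 < (lazy P ^ k) i j → 0 < (lazy P ^ (k + 1)) i j := by
    intro k i j h
    rw [pow_succ, Matrix.mul_apply]
    refine Finset.sum_pos' (fun l _ => mul_nonneg ?_ ?_) ⟨j, Finset.mem_univ _, mul_pos h ?_⟩
    · exact Matrix.nonneg_of_mem_colStochastic (pow_mem (lazy_mem_colStochastic hP) k)
    · exact Matrix.nonneg_of_mem_colStochastic (lazy_mem_colStochastic hP)
    · have := hnn j j
      simp only [lazy, Matrix.smul_apply, Matrix.add_apply, smul_eq_mul, Matrix.one_apply_eq]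
      linarith
  choose k _ hk using (Matrix.isIrreducible_iff_exists_pow_pos hnn).1 hirr
  refine ⟨∑ i, ∑ j, k i j, fun i j => ?_⟩
  have hle : k i j ≤ ∑ i, ∑ j, k i j :=
    (Finset.single_le_sum (f := fun j => k i j) (fun _ _ => Nat.zero_le _)
      (Finset.mem_univ j)).trans
      (Finset.single_le_sum (f := fun i => ∑ j, k i j) (fun _ _ => Nat.zero_le _)
        (Finset.mem_univ i))
  refine Nat.le_induction (m := k i j) (P := fun n _ => 0 < (lazy P ^ n) i j) ?_
    (fun n _ h => hstep n i j h) _ hle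
  exact (mul_pos (by positivity) (hk i j)).trans_le (pow_le_lazy_pow hnn _ i j).2

/-- The seminorm `y ↦ ∑_{k < m} ‖Q ^ k y‖₁`. -/
noncomputable def orbitSeminorm (Q : Matrix ι ι ℝ) (m : ℕ) : Seminorm ℝ (ι → ℝ) :=
  Seminorm.of (fun y => ∑ k ∈ Finset.range m, ∑ i, |((Q ^ k) *ᵥ y) i|)
    (fun x y => by
      rw [← Finset.sum_add_distrib]
      refine Finset.sum_le_sum fun k _ => ?_
      rw [← Finset.sum_add_distrib]
      refine Finset.sum_le_sum fun i _ => ?_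
      rw [Matrix.mulVec_add]
      exact abs_add_le _ _)
    (fun a y => by
      simp only [Matrix.mulVec_smul, Pi.smul_apply, smul_eq_mul, abs_mul, Real.norm_eq_abs,
        Finset.mul_sum])

lemma orbitSeminorm_apply (Q : Matrix ι ι ℝ) (m : ℕ) (y : ι → ℝ) :
    orbitSeminorm Q m y = ∑ k ∈ Finset.range m, ∑ i, |((Q ^ k) *ᵥ y) i| := rfl

/-- If `Q ^ m` contracts the `ℓ¹`-norm of `y`, then `Q` itself contracts the orbit seminorm of
`y`: applying `Q` replaces the first term of the sum by the `m`-th one. -/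
lemma orbitSeminorm_mulVec_le {Q : Matrix ι ι ℝ} (hQ : Q ∈ Matrix.colStochastic ℝ ι) {m : ℕ}
    (hm : 0 < m) {η : ℝ} (hη : 0 ≤ η) {y : ι → ℝ}
    (hy : ∑ i, |((Q ^ m) *ᵥ y) i| ≤ (1 - η) * ∑ i, |y i|) :
    orbitSeminorm Q m (Q *ᵥ y) ≤ (1 - η / m) * orbitSeminorm Q m y := by
  have hshift : orbitSeminorm Q m (Q *ᵥ y) + ∑ i, |y i|
      = orbitSeminorm Q m y + ∑ i, |((Q ^ m) *ᵥ y) i| := by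
    simp only [orbitSeminorm_apply, Matrix.mulVec_mulVec, ← pow_succ]
    rw [← Finset.sum_range_succ (fun k => ∑ i, |((Q ^ k) *ᵥ y) i|), Finset.sum_range_succ']
    simp
  have hle : orbitSeminorm Q m y ≤ m * ∑ i, |y i| := by
    rw [orbitSeminorm_apply]
    refine (Finset.sum_le_card_nsmul _ _ (∑ i, |y i|) fun k _ =>
      sum_abs_mulVec_le_of_mem_colStochastic (pow_mem hQ k) y).trans ?_
    simp
  have hm' : (0 : ℝ) < m := by exact_mod_cast hm
  have : η / m * orbitSeminorm Q m y ≤ η * ∑ i, |y i| := by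
    calc η / m * orbitSeminorm Q m y ≤ η / m * (m * ∑ i, |y i|) := by gcongr
      _ = η * ∑ i, |y i| := by field_simp
  linarith

/-- An irreducible stochastic matrix `P` admits a norm for which every Euler step of
`y' = P y - y` of size at most `1 / 2` contracts the vectors of weight zero. -/
theorem exists_contracting_seminorm [Nonempty ι] {P : Matrix ι ι ℝ}
    (hP : P ∈ Matrix.colStochastic ℝ ι) (hirr : P.IsIrreducible) :
    ∃ V : Seminorm ℝ (ι → ℝ), Continuous V ∧ (∀ y i, |y i| ≤ V y) ∧
      ∃ c > 0, c ≤ 1 ∧ ∀ y : ι → ℝ, ∑ i, y i = 0 → ∀ a : ℝ, 0 ≤ a → a ≤ 1 / 2 →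
        V (y + a • (P *ᵥ y - y)) ≤ (1 - c * a) * V y := by
  have hQ := lazy_mem_colStochastic hP
  obtain ⟨m₀, hm₀⟩ := exists_lazy_pow_pos hP hirr
  -- the exponent has to be positive for the orbit seminorm to dominate the coordinates
  obtain ⟨m, hm, hpos⟩ : ∃ m, 0 < m ∧ ∀ i j, 0 < (lazy P ^ m) i j := by
    rcases Nat.eq_zero_or_pos m₀ with rfl | h
    · refine ⟨1, one_pos, fun i j => ?_⟩
      have hij : i = j := by
        by_contra h
        simpa [h] using hm₀ i j
      subst hij
      have := hirr.nonneg i i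
      simp only [pow_one, lazy, Matrix.smul_apply, Matrix.add_apply, smul_eq_mul,
        Matrix.one_apply_eq]
      linarith
    · exact ⟨m₀, h, hm₀⟩
  have hm' : (0 : ℝ) < m := by exact_mod_cast hm
  obtain ⟨⟨i₀, j₀⟩, hmin⟩ := Finite.exists_min fun p : ι × ι => (lazy P ^ m) p.1 p.2
  set η := (lazy P ^ m) i₀ j₀ with hη_def
  have hη : 0 < η := hpos i₀ j₀
  have hcard : (0 : ℝ) < Fintype.card ι := by exact_mod_cast Fintype.card_pos
  set θ : ℝ := Fintype.card ι * η with hθ_def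
  have hθ : 0 < θ := mul_pos hcard hη
  have hcol := Matrix.sum_col_of_mem_colStochastic (pow_mem hQ m)
  have hθ1 : θ ≤ 1 := by
    rw [← hcol j₀]
    calc θ = ∑ _i : ι, η := by simp [hθ_def]
      _ ≤ _ := Finset.sum_le_sum fun i _ => hmin (i, j₀)
  set V := orbitSeminorm (lazy P) m
  refine ⟨V, ?_, fun y i => ?_, θ / m, by positivity, ?_, fun y hy a ha0 ha1 => ?_⟩
  · change Continuous fun y : ι → ℝ => ∑ k ∈ Finset.range m, ∑ i, |((lazy P ^ k) *ᵥ y) i|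
    refine continuous_finsetSum _ fun k _ => continuous_finsetSum _ fun i _ => ?_
    exact ((continuous_apply i).comp (continuous_const.matrix_mulVec continuous_id)).abs
  · calc |y i| ≤ ∑ i, |y i| :=
          Finset.single_le_sum (f := fun i => |y i|) (fun _ _ => abs_nonneg _) (Finset.mem_univ i)
      _ = ∑ i, |((lazy P ^ 0) *ᵥ y) i| := by simp
      _ ≤ V y := Finset.single_le_sum (f := fun k => ∑ i, |((lazy P ^ k) *ᵥ y) i|)
          (fun _ _ => Finset.sum_nonneg fun _ _ => abs_nonneg _) (Finset.mem_range.2 hm)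
  · rw [div_le_one hm']
    exact hθ1.trans (by exact_mod_cast hm)
  · have hV := orbitSeminorm_mulVec_le hQ hm hθ.le
      (sum_abs_mulVec_le_of_le (fun i j => hmin (i, j)) hcol hy)
    have hsplit : y + a • (P *ᵥ y - y) = (1 - 2 * a) • y + (2 * a) • (lazy P *ᵥ y) := by
      rw [lazy_mulVec]
      ext i
      simp only [Pi.add_apply, Pi.smul_apply, Pi.sub_apply, smul_eq_mul]
      ring
    rw [hsplit]
    refine (map_add_le_add V _ _).trans ?_
    rw [map_smul_eq_mul, map_smul_eq_mul, Real.norm_of_nonneg (by linarith),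
      Real.norm_of_nonneg (by linarith)]
    have h0 : 0 ≤ V y := apply_nonneg V y
    have h1 : 2 * a * V (lazy P *ᵥ y) ≤ 2 * a * ((1 - θ / m) * V y) := by gcongr
    have h2 : 0 ≤ θ / m * a * V y := by positivity
    nlinarith

/-- A weight-zero fixed vector of an irreducible stochastic matrix vanishes. -/
lemma eq_zero_of_mulVec_eq_self [Nonempty ι] {P : Matrix ι ι ℝ}
    (hP : P ∈ Matrix.colStochastic ℝ ι) (hirr : P.IsIrreducible) {y : ι → ℝ}
    (hy : ∑ i, y i = 0) (hPy : P *ᵥ y = y) : y = 0 := by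
  obtain ⟨V, -, hdom, c, hc, -, hcontr⟩ := exists_contracting_seminorm hP hirr
  have h := hcontr y hy (1 / 2) (by norm_num) le_rfl
  rw [hPy, sub_self, smul_zero, add_zero] at h
  have h0 : V y ≤ 0 := by nlinarith [apply_nonneg V y]
  ext i
  exact abs_nonpos_iff.1 ((hdom y i).trans h0)

lemma exists_fixed_vector [Nonempty ι] {P : Matrix ι ι ℝ}
    (hP : P ∈ Matrix.colStochastic ℝ ι) (hirr : P.IsIrreducible) :
    ∃ v : ι → ℝ, ∑ i, v i = 1 ∧ P *ᵥ v = v := by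
  have hdet : (P - 1).det = 0 := by
    refine Matrix.exists_vecMul_eq_zero_iff.1 ⟨1, one_ne_zero, ?_⟩
    rw [Matrix.vecMul_sub, Matrix.vecMul_one, Matrix.one_vecMul_of_mem_colStochastic hP, sub_self]
  obtain ⟨w, hw0, hw⟩ := Matrix.exists_mulVec_eq_zero_iff.2 hdet
  rw [Matrix.sub_mulVec, Matrix.one_mulVec, sub_eq_zero] at hw
  have hs : ∑ i, w i ≠ 0 := fun h => hw0 (eq_zero_of_mulVec_eq_self hP hirr h hw)
  refine ⟨(∑ i, w i)⁻¹ • w, ?_, by rw [Matrix.mulVec_smul, hw]⟩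
  simp only [Pi.smul_apply, smul_eq_mul, ← Finset.mul_sum]
  exact inv_mul_cancel₀ hs

/-- The constant column sum of a nonnegative matrix bounds the real parts of its eigenvalues. -/
lemma re_le_of_mem_spectrum {H : Matrix ι ι ℝ} (hH : ∀ i j, 0 ≤ H i j) {γ : ℝ}
    (hγ : ∀ j, ∑ i, H i j = γ) {z : ℂ}
    (hz : z ∈ spectrum ℂ (H.map (fun x : ℝ => (x : ℂ)))) : z.re ≤ γ := by
  rw [spectrum.mem_iff, Matrix.isUnit_iff_isUnit_det, isUnit_iff_ne_zero, not_not] at hz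
  obtain ⟨w, hw0, hw⟩ := Matrix.exists_mulVec_eq_zero_iff.2 hz
  rw [Matrix.sub_mulVec, sub_eq_zero, Algebra.algebraMap_eq_smul_one, Matrix.smul_mulVec,
    Matrix.one_mulVec] at hw
  have hpos : 0 < ∑ i, ‖w i‖ := by
    obtain ⟨i, hi⟩ := Function.ne_iff.1 hw0
    exact Finset.sum_pos' (fun _ _ => norm_nonneg _) ⟨i, Finset.mem_univ _, norm_pos_iff.2 hi⟩
  have hle : ‖z‖ * ∑ i, ‖w i‖ ≤ γ * ∑ i, ‖w i‖ := by
    calc ‖z‖ * ∑ i, ‖w i‖ = ∑ i, ‖(H.map (fun x : ℝ => (x : ℂ)) *ᵥ w) i‖ := by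
          rw [← hw, Finset.mul_sum]; simp
      _ ≤ ∑ i, (H *ᵥ fun j => ‖w j‖) i := by
          refine Finset.sum_le_sum fun i _ => (norm_sum_le _ _).trans (le_of_eq ?_)
          exact Finset.sum_congr rfl fun j _ => by simp [abs_of_nonneg (hH i j)]
      _ = γ * ∑ i, ‖w i‖ := by rw [sum_mulVec, Finset.mul_sum]; simp only [hγ]
  exact (Complex.re_le_norm z).trans (le_of_mul_le_mul_right hle hpos)

lemma inv_smul_mem_colStochastic {H : Matrix ι ι ℝ} (hH : ∀ i j, 0 ≤ H i j) {γ : ℝ}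
    (hγ : 0 < γ) (hsum : ∀ j, ∑ i, H i j = γ) : γ⁻¹ • H ∈ Matrix.colStochastic ℝ ι := by
  refine Matrix.mem_colStochastic_iff_sum.2 ⟨fun i j => ?_, fun j => ?_⟩
  · exact mul_nonneg (inv_nonneg.2 hγ.le) (hH i j)
  · simp only [Matrix.smul_apply, smul_eq_mul, ← Finset.mul_sum, hsum]
    exact inv_mul_cancel₀ hγ.ne'

lemma isIrreducible_smul {H : Matrix ι ι ℝ} (hH : H.IsIrreducible) {c : ℝ} (hc : 0 < c) :
    (c • H).IsIrreducible := by
  have hnn : ∀ i j, 0 ≤ (c • H) i j := fun i j => mul_nonneg hc.le (hH.nonneg i j)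
  refine (Matrix.isIrreducible_iff_exists_pow_pos hnn).2 fun i j => ?_
  obtain ⟨k, hk, hpos⟩ := (Matrix.isIrreducible_iff_exists_pow_pos hH.nonneg).1 hH i j
  refine ⟨k, hk, ?_⟩
  rw [smul_pow, Matrix.smul_apply, smul_eq_mul]
  positivity

lemma pos_of_isIrreducible_of_sum_eq [Nonempty ι] {H : Matrix ι ι ℝ} {γ : ℝ}
    (hH : H.IsIrreducible) (hsum : ∀ j, ∑ i, H i j = γ) : 0 < γ := by
  have i₀ := Classical.arbitrary ι
  obtain ⟨k, hk, hpos⟩ := (Matrix.isIrreducible_iff_exists_pow_pos hH.nonneg).1 hH i₀ i₀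
  have hγ : 0 ≤ γ := by
    rw [← hsum i₀]; exact Finset.sum_nonneg fun i _ => hH.nonneg i i₀
  refine hγ.lt_of_ne fun h => hpos.ne' ?_
  have hzero : H = 0 := by
    ext i j
    have := (Finset.sum_eq_zero_iff_of_nonneg fun i _ => hH.nonneg i j).1 ((hsum j).trans h.symm)
    exact this i (Finset.mem_univ i)
  rw [hzero, zero_pow hk.ne', Matrix.zero_apply]

end Contraction

/-! ### Deterministic stochastic approximation -/

section StochasticApproximation

/-- A recursive inequality with divergent total step size and vanishing perturbation forces
convergence to zero: for each `ε`, the excess `u n - ε` eventually decays like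
`exp (-c ∑ a)`. -/
lemma tendsto_zero_of_le_contraction {u a e : ℕ → ℝ} {c : ℝ} (hc : 0 < c)
    (hu : ∀ n, 0 ≤ u n) (ha : Tendsto (fun n => ∑ k ∈ Finset.range n, a k) atTop atTop)
    (he : Tendsto e atTop (𝓝 0))
    (hrec : ∀ᶠ n in atTop, 0 ≤ a n ∧ c * a n ≤ 1 ∧
      u (n + 1) ≤ (1 - c * a n) * u n + a n * e n) :
    Tendsto u atTop (𝓝 0) := by
  rw [Metric.tendsto_atTop]
  intro ε hε
  obtain ⟨n₀, hn₀⟩ := eventually_atTop.1 (hrec.and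
    (he.eventually (ge_mem_nhds (show (0 : ℝ) < c * (ε / 2) by positivity))))
  set B := max (u n₀ - ε / 2) 0
  have hB : 0 ≤ B := le_max_right _ _
  have hdecay : ∀ n, n₀ ≤ n → u n - ε / 2 ≤
      Real.exp (-c * (∑ k ∈ Finset.range n, a k - ∑ k ∈ Finset.range n₀, a k)) * B := by
    intro n hn
    induction n, hn using Nat.le_induction with
    | base => simp [B]
    | succ n hn ih =>
      obtain ⟨⟨ha0, hca, hstep⟩, hen⟩ := hn₀ n hn
      have h1 : a n * e n ≤ a n * (c * (ε / 2)) := by gcongr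
      have hexp : 1 - c * a n ≤ Real.exp (-c * a n) := by
        have := Real.add_one_le_exp (-c * a n); linarith
      calc u (n + 1) - ε / 2 ≤ (1 - c * a n) * (u n - ε / 2) := by linarith
        _ ≤ (1 - c * a n) * (Real.exp (-c * (∑ k ∈ Finset.range n, a k
              - ∑ k ∈ Finset.range n₀, a k)) * B) :=
            mul_le_mul_of_nonneg_left ih (by linarith)
        _ ≤ Real.exp (-c * a n) * (Real.exp (-c * (∑ k ∈ Finset.range n, a k
              - ∑ k ∈ Finset.range n₀, a k)) * B) := by gcongr
        _ = _ := by
            rw [← mul_assoc, ← Real.exp_add, Finset.sum_range_succ]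
            ring_nf
  have hlim : Tendsto (fun n => Real.exp (-c * (∑ k ∈ Finset.range n, a k
      - ∑ k ∈ Finset.range n₀, a k)) * B) atTop (𝓝 0) := by
    rw [← zero_mul B]
    refine (Real.tendsto_exp_atBot.comp ?_).mul_const B
    exact (tendsto_atTop_add_const_right _ _ ha).const_mul_atTop_of_neg (by linarith)
  obtain ⟨n₁, hn₁⟩ := eventually_atTop.1
    (hlim.eventually (gt_mem_nhds (show (0 : ℝ) < ε / 2 by positivity)))
  refine ⟨max n₀ n₁, fun n hn => ?_⟩
  have h1 := hdecay n (le_of_max_le_left hn)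
  have h2 := hn₁ n (le_of_max_le_right hn)
  rw [Real.dist_eq, sub_zero, abs_of_nonneg (hu n)]
  linarith

variable {ι : Type*} [Fintype ι] [DecidableEq ι]

/-- Deterministic stochastic approximation for `x' = P x - x`: weight-one iterates with a
vanishing drift error `δ` and a convergent series of noise terms `D` approach the fixed vector
of `P`. -/
theorem tendsto_of_stochastic_approximation [Nonempty ι] {P : Matrix ι ι ℝ}
    (hP : P ∈ Matrix.colStochastic ℝ ι) (hirr : P.IsIrreducible) {v : ι → ℝ}
    (hv : ∑ i, v i = 1) (hPv : P *ᵥ v = v) {X δ D : ℕ → ι → ℝ} {a : ℕ → ℝ} {L : ι → ℝ}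
    (hX : ∀ n, ∑ i, X n i = 1) (hδ : ∀ n, ∑ i, δ n i = 0)
    (hδ0 : Tendsto δ atTop (𝓝 0)) (ha_nonneg : ∀ n, 0 ≤ a n) (ha0 : Tendsto a atTop (𝓝 0))
    (ha : Tendsto (fun n => ∑ k ∈ Finset.range n, a k) atTop atTop)
    (hD : Tendsto (fun n => ∑ k ∈ Finset.range n, D k) atTop (𝓝 L))
    (hrec : ∀ n, X (n + 1) = X n + a n • (P *ᵥ X n - X n + δ n) + D n) :
    Tendsto X atTop (𝓝 v) := by
  obtain ⟨V, hVcont, hdom, c, hc, hc1, hcontr⟩ := exists_contracting_seminorm hP hirr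
  have hPsum : ∀ y : ι → ℝ, ∑ i, (P *ᵥ y) i = ∑ i, y i := fun y => by
    rw [sum_mulVec]; simp [Matrix.sum_col_of_mem_colStochastic hP]
  have hDsum : ∀ n, ∑ i, D n i = 0 := by
    intro n
    have h : ∑ i, X (n + 1) i = ∑ i, (X n + a n • (P *ᵥ X n - X n + δ n) + D n) i := by
      rw [hrec]
    simp only [Pi.add_apply, Pi.smul_apply, Pi.sub_apply, smul_eq_mul, Finset.sum_add_distrib,
      ← Finset.mul_sum, Finset.sum_sub_distrib, hX, hδ, hPsum] at h
    linarith
  have hSsum : ∀ n, ∑ i, (∑ k ∈ Finset.range n, D k) i = 0 := by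
    intro n
    simp only [Finset.sum_apply]
    rw [Finset.sum_comm]
    exact Finset.sum_eq_zero fun k _ => hDsum k
  have hLsum : ∑ i, L i = 0 := by
    refine tendsto_nhds_unique (tendsto_finsetSum Finset.univ fun i _ => tendsto_pi_nhds.1 hD i) ?_
    simp only [hSsum]
    exact tendsto_const_nhds
  -- adding the tail `W` of the noise series removes the noise from the recursion
  set W : ℕ → ι → ℝ := fun n => L - ∑ k ∈ Finset.range n, D k with hW
  have hW0 : Tendsto W atTop (𝓝 0) := by
    simpa using (tendsto_const_nhds (x := L)).sub hD
  have hWsucc : ∀ n, W (n + 1) = W n - D n := fun n => by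
    simp only [hW, Finset.sum_range_succ]; abel
  set z : ℕ → ι → ℝ := fun n => X n - v + W n with hz
  have hzsum : ∀ n, ∑ i, z n i = 0 := fun n => by
    simp only [hz, hW, Pi.add_apply, Pi.sub_apply, Finset.sum_add_distrib,
      Finset.sum_sub_distrib, hX, hv, hLsum, hSsum]
    norm_num
  set r : ℕ → ι → ℝ := fun n => δ n - (P *ᵥ W n - W n) with hr
  have hr0 : Tendsto r atTop (𝓝 0) := by
    have hcont : Continuous fun w : ι → ℝ => P *ᵥ w - w :=
      (continuous_const.matrix_mulVec continuous_id).sub continuous_id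
    have := hδ0.sub ((hcont.tendsto 0).comp hW0)
    simpa using this
  have hzrec : ∀ n, z (n + 1) = (z n + a n • (P *ᵥ z n - z n)) + a n • r n := by
    intro n
    simp only [hz, hr, hrec, hWsucc, Matrix.mulVec_add, Matrix.mulVec_sub, hPv, smul_sub,
      smul_add]
    abel
  have hVz : Tendsto (fun n => V (z n)) atTop (𝓝 0) := by
    refine tendsto_zero_of_le_contraction hc (fun n => apply_nonneg V _) ha
      (e := fun n => V (r n)) ?_ ?_
    · rw [← map_zero V]
      exact (hVcont.tendsto 0).comp hr0
    · filter_upwards [ha0.eventually (ge_mem_nhds (show (0 : ℝ) < 1 / 2 by norm_num))] with n hn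
      refine ⟨ha_nonneg n, by nlinarith [ha_nonneg n], ?_⟩
      rw [hzrec]
      refine (map_add_le_add V _ _).trans ?_
      rw [map_smul_eq_mul, Real.norm_of_nonneg (ha_nonneg n)]
      gcongr
      exact hcontr _ (hzsum n) _ (ha_nonneg n) hn
  have hz0 : Tendsto z atTop (𝓝 0) := by
    refine tendsto_pi_nhds.2 fun i => ?_
    exact squeeze_zero_norm (fun n => hdom (z n) i) hVz
  have hXz : X = fun n => z n + v - W n := by
    funext n; simp only [hz]; abel
  rw [hXz]
  simpa using (hz0.add_const v).sub hW0

end StochasticApproximation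

/-! ### Convergence of martingale series -/

section MartingaleSeries

variable {Ω : Type*} {m0 : MeasurableSpace Ω} {μ : Measure Ω} [IsProbabilityMeasure μ]

/-- A series of martingale differences with square-summable deterministic bounds converges almost
surely: the partial sums form a martingale bounded in `L²`. -/
theorem ae_exists_tendsto_sum_of_condExp_eq_zero {ℱ : Filtration ℕ m0} {D : ℕ → Ω → ℝ}
    (hD : ∀ n, StronglyMeasurable[ℱ (n + 1)] (D n)) {b : ℕ → ℝ}
    (hb : ∀ n, ∀ᵐ ω ∂μ, |D n ω| ≤ b n) (hsum : Summable fun n => b n ^ 2)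
    (h0 : ∀ n, μ[D n | ℱ n] =ᵐ[μ] 0) :
    ∀ᵐ ω ∂μ, ∃ c, Tendsto (fun n => ∑ k ∈ Finset.range n, D k ω) atTop (𝓝 c) := by
  set S : ℕ → Ω → ℝ := fun n ω => ∑ k ∈ Finset.range n, D k ω with hS
  have hSsucc : ∀ n, S (n + 1) = S n + D n := fun n => by
    ext ω; simp [hS, Finset.sum_range_succ]
  have hSm : ∀ n, StronglyMeasurable[ℱ n] (S n) := fun n =>
    Finset.stronglyMeasurable_fun_sum _ fun k hk =>
      (hD k).mono (ℱ.mono (Finset.mem_range.1 hk))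
  have hSb : ∀ n, ∀ᵐ ω ∂μ, ‖S n ω‖ ≤ ∑ k ∈ Finset.range n, b k := fun n => by
    filter_upwards [ae_all_iff.2 hb] with ω hω
    exact (norm_sum_le _ _).trans (Finset.sum_le_sum fun k _ => hω k)
  have hSaesm : ∀ n, AEStronglyMeasurable (S n) μ := fun n =>
    ((hSm n).mono (ℱ.le n)).aestronglyMeasurable
  have hDaesm : ∀ n, AEStronglyMeasurable (D n) μ := fun n =>
    ((hD n).mono (ℱ.le _)).aestronglyMeasurable
  have hSint : ∀ n, Integrable (S n) μ := fun n => Integrable.of_bound (hSaesm n) _ (hSb n)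
  have hDint : ∀ n, Integrable (D n) μ := fun n => Integrable.of_bound (hDaesm n) _ (hb n)
  have hmart : Martingale S ℱ μ := by
    refine martingale_of_condExp_sub_eq_zero_nat hSm hSint fun n => ?_
    rw [hSsucc, add_sub_cancel_left]
    exact h0 n
  have hSSint : ∀ n, Integrable (S n * S n) μ := fun n =>
    (hSint n).bdd_mul (hSaesm n) (hSb n)
  have hSDint : ∀ n, Integrable (S n * D n) μ := fun n =>
    (hDint n).bdd_mul (hSaesm n) (hSb n)
  have hDDint : ∀ n, Integrable (D n * D n) μ := fun n =>
    (hDint n).bdd_mul (hDaesm n) (hb n)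
  have horth : ∀ n, ∫ ω, (S n * D n) ω ∂μ = 0 := fun n => by
    rw [← integral_condExp (ℱ.le n)]
    refine (integral_congr_ae ?_).trans (integral_zero Ω ℝ)
    filter_upwards [condExp_mul_of_stronglyMeasurable_left (hSm n) (hSDint n) (hDint n), h0 n]
      with ω h1 h2
    rw [h1, Pi.mul_apply, h2]
    simp
  have hL2 : ∀ n, ∫ ω, (S n * S n) ω ∂μ ≤ ∑ k ∈ Finset.range n, b k ^ 2 := by
    intro n
    induction n with
    | zero => simp [hS]
    | succ n ih =>
      have hexp : S (n + 1) * S (n + 1) = S n * S n + (2 : ℝ) • (S n * D n) + D n * D n := by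
        rw [hSsucc]
        ext ω
        simp only [Pi.add_apply, Pi.mul_apply, Pi.smul_apply, smul_eq_mul]
        ring
      have hDD : ∫ ω, (D n * D n) ω ∂μ ≤ b n ^ 2 := by
        have h := integral_mono_ae (hDDint n) (integrable_const (b n ^ 2)) (by
          filter_upwards [hb n] with ω hω
          rw [Pi.mul_apply, ← pow_two, ← sq_abs]
          gcongr)
        simpa using h
      rw [hexp, integral_add' ((hSSint n).add ((hSDint n).smul _)) (hDDint n),
        integral_add' (hSSint n) ((hSDint n).smul _), Finset.sum_range_succ]
      simp only [Pi.smul_apply, integral_smul, horth, smul_zero, add_zero]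
      linarith
  refine hmart.submartingale.exists_ae_tendsto_of_bdd (R := (1 + ∑' k, b k ^ 2).toNNReal) fun n => ?_
  rw [eLpNorm_one_eq_lintegral_enorm, ← ofReal_integral_norm_eq_lintegral_enorm (hSint n)]
  refine ENNReal.ofReal_le_ofReal ?_
  calc ∫ ω, ‖S n ω‖ ∂μ ≤ ∫ ω, (1 + (S n * S n) ω) ∂μ := by
        refine integral_mono (hSint n).norm ((integrable_const 1).add (hSSint n)) fun ω => ?_
        simp only [Pi.mul_apply, Real.norm_eq_abs]
        nlinarith [sq_nonneg (|S n ω| - 1), abs_mul_abs_self (S n ω)]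
    _ = 1 + ∫ ω, (S n * S n) ω ∂μ := by
        rw [integral_add (integrable_const 1) (hSSint n)]; simp
    _ ≤ 1 + ∑' k, b k ^ 2 := by
        have := hsum.sum_le_tsum (Finset.range n) (fun k _ => sq_nonneg (b k))
        linarith [hL2 n]

end MartingaleSeries

/-! ### Conditional laws and conditional expectations -/

section ConditionalExpectation

variable {Ω : Type*} {G m' m0 : MeasurableSpace Ω} {μ : Measure Ω}

lemma norm_condExp_indicator_one_le (A : Set Ω) : ∀ᵐ ω ∂μ, ‖(μ⟦A | G⟧) ω‖ ≤ 1 := by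
  refine ae_bdd_abs_condExp_of_ae_bdd_abs (R := 1) (ae_of_all _ fun ω => ?_)
  by_cases h : ω ∈ A <;> simp [h]

variable [IsProbabilityMeasure μ]

lemma integrable_indicator_one {A : Set Ω} (hA : MeasurableSet A) :
    Integrable (A.indicator fun _ => (1 : ℝ)) μ :=
  (integrable_const 1).indicator hA

/-- The conditional probability of `A` can be multiplied with `r` or with its conditional
expectation under an integral over an event of `G`. -/
lemma setIntegral_condProb_mul (hG : G ≤ m0) {A T : Set Ω} (hT : MeasurableSet[G] T) {r : Ω → ℝ}
    (hr : Integrable r μ) :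
    ∫ ω in T, (μ⟦A | G⟧ * r) ω ∂μ = ∫ ω in T, (μ⟦A | G⟧ * μ[r | G]) ω ∂μ := by
  have hint : Integrable (μ⟦A | G⟧ * r) μ :=
    hr.bdd_mul (stronglyMeasurable_condExp.mono hG).aestronglyMeasurable
      (norm_condExp_indicator_one_le A)
  rw [← setIntegral_condExp hG hint hT]
  refine integral_congr_ae (ae_restrict_of_ae ?_)
  exact condExp_mul_of_stronglyMeasurable_left stronglyMeasurable_condExp hint hr

/-- If the event `A` is conditionally independent of the σ-algebra `m'` given `G`, then the
conditional expectation of `1_A r` factorizes for every bounded `m'`-measurable `r`.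
The function `1_T (1_A - P(A | G))` integrates to zero over the events of `m'` for each `T` in
`G`, hence is orthogonal to `r`. -/
theorem condExp_indicator_of_condIndep (hG : G ≤ m0) (hm' : m' ≤ m0) {A : Set Ω}
    (hA : MeasurableSet A)
    (hind : ∀ B, MeasurableSet[m'] B → μ⟦A ∩ B | G⟧ =ᵐ[μ] μ⟦A | G⟧ * μ⟦B | G⟧)
    {r : Ω → ℝ} (hr : StronglyMeasurable[m'] r) {K : ℝ} (hK : ∀ᵐ ω ∂μ, ‖r ω‖ ≤ K) :
    μ[A.indicator r | G] =ᵐ[μ] μ⟦A | G⟧ * μ[r | G] := by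
  set p : Ω → ℝ := μ⟦A | G⟧ with hp
  have hraesm : AEStronglyMeasurable r μ := (hr.mono hm').aestronglyMeasurable
  have hrint : Integrable r μ := Integrable.of_bound hraesm K hK
  have hpm : StronglyMeasurable[G] p := stronglyMeasurable_condExp
  have hpaesm : AEStronglyMeasurable p μ := (hpm.mono hG).aestronglyMeasurable
  have hpint : Integrable p μ := integrable_condExp
  have hpb : ∀ᵐ ω ∂μ, ‖p ω‖ ≤ 1 := norm_condExp_indicator_one_le A
  refine (ae_eq_condExp_of_forall_setIntegral_eq hG (hrint.indicator hA)
    (fun T _ _ => (integrable_condExp.bdd_mul hpaesm hpb).integrableOn) (fun T hT _ => ?_)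
    (hpm.mul stronglyMeasurable_condExp).aestronglyMeasurable).symm
  have hT0 : MeasurableSet T := hG T hT
  refine (setIntegral_condProb_mul hG hT hrint).symm.trans ?_
  set g : Ω → ℝ := T.indicator ((A.indicator fun _ => (1 : ℝ)) - p) with hg
  have hgint : Integrable g μ := ((integrable_indicator_one hA).sub hpint).indicator hT0
  have hg0 : μ[g | m'] =ᵐ[μ] 0 := by
    refine (ae_eq_condExp_of_forall_setIntegral_eq hm' hgint
      (fun _ _ _ => (integrable_zero Ω ℝ μ).integrableOn) (fun B hB _ => ?_)
      aestronglyMeasurable_zero).symm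
    have hB0 : MeasurableSet B := hm' B hB
    have hpB : Integrable (p * B.indicator fun _ => (1 : ℝ)) μ :=
      (integrable_indicator_one hB0).bdd_mul hpaesm hpb
    have h1 : ∫ ω in T, (A ∩ B).indicator (fun _ => (1 : ℝ)) ω ∂μ
        = ∫ ω in T, (p * B.indicator fun _ => (1 : ℝ)) ω ∂μ := by
      rw [setIntegral_condProb_mul hG hT (integrable_indicator_one hB0),
        ← setIntegral_condExp hG (integrable_indicator_one (hA.inter hB0)) hT]
      exact integral_congr_ae (ae_restrict_of_ae (hind B hB))
    have h2 : ∫ ω in B, g ω ∂μ = ∫ ω in T, (((A ∩ B).indicator fun _ => (1 : ℝ))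
        - (p * B.indicator fun _ => (1 : ℝ))) ω ∂μ := by
      rw [← integral_indicator hB0, ← integral_indicator hT0]
      refine integral_congr_ae (ae_of_all _ fun ω => ?_)
      by_cases hωB : ω ∈ B <;> by_cases hωT : ω ∈ T <;> by_cases hωA : ω ∈ A <;>
        simp [hg, hωA, hωB, hωT]
    rw [h2, integral_sub' (integrable_indicator_one (hA.inter hB0)).integrableOn
      hpB.integrableOn, h1]
    simp
  have hgr : ∫ ω, (g * r) ω ∂μ = 0 := by
    have hint : Integrable (g * r) μ := hgint.mul_bdd hraesm hK
    rw [← integral_condExp hm']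
    refine (integral_congr_ae ?_).trans (integral_zero Ω ℝ)
    filter_upwards [condExp_mul_of_stronglyMeasurable_right hr hint hgint, hg0] with ω h1 h2
    rw [h1, Pi.mul_apply, h2]
    simp
  have hpr : Integrable (p * r) μ := hrint.bdd_mul hpaesm hpb
  have hsub : ∫ ω, (g * r) ω ∂μ = ∫ ω in T, (A.indicator r - p * r) ω ∂μ := by
    rw [← integral_indicator hT0]
    refine integral_congr_ae (ae_of_all _ fun ω => ?_)
    by_cases hωT : ω ∈ T <;> by_cases hωA : ω ∈ A <;> simp [hg, hωA, hωT, sub_mul]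
  rw [hgr, integral_sub' (hrint.indicator hA).integrableOn hpr.integrableOn] at hsub
  linarith

/-- Random elements with the same conditional law given `G` have the same conditional
expectations of observables. -/
theorem condExp_comp_congr {E : Type*} [MeasurableSpace E] (hG : G ≤ m0) {f g : Ω → E}
    (hf : Measurable f) (hg : Measurable g)
    (hfg : ∀ A, MeasurableSet A → μ⟦f ⁻¹' A | G⟧ =ᵐ[μ] μ⟦g ⁻¹' A | G⟧)
    {φ : E → ℝ} (hφ : Measurable φ) (hφf : Integrable (fun ω => φ (f ω)) μ)
    (hφg : Integrable (fun ω => φ (g ω)) μ) :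
    μ[fun ω => φ (f ω) | G] =ᵐ[μ] μ[fun ω => φ (g ω) | G] := by
  refine ae_eq_condExp_of_forall_setIntegral_eq hG hφg
    (fun _ _ _ => integrable_condExp.integrableOn) (fun T hT _ => ?_)
    stronglyMeasurable_condExp.aestronglyMeasurable
  rw [setIntegral_condExp hG hφf hT]
  have hmap : (μ.restrict T).map f = (μ.restrict T).map g := by
    ext A hA
    have h : ∫ ω in T, (f ⁻¹' A).indicator (fun _ => (1 : ℝ)) ω ∂μ
        = ∫ ω in T, (g ⁻¹' A).indicator (fun _ => (1 : ℝ)) ω ∂μ := by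
      rw [← setIntegral_condExp hG (integrable_indicator_one (hf hA)) hT,
        ← setIntegral_condExp hG (integrable_indicator_one (hg hA)) hT]
      exact integral_congr_ae (ae_restrict_of_ae (hfg A hA))
    rw [integral_indicator (hf hA), integral_indicator (hg hA)] at h
    simp only [setIntegral_const, smul_eq_mul, mul_one] at h
    rw [Measure.map_apply hf hA, Measure.map_apply hg hA]
    exact (measureReal_eq_measureReal_iff).1 h
  rw [← integral_map (φ := f) (f := φ) hf.aemeasurable hφ.aestronglyMeasurable,
    ← integral_map (φ := g) (f := φ) hg.aemeasurable hφ.aestronglyMeasurable, hmap]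

/-- If the conditional probabilities of the disjoint events `A j` add up to one, then almost
surely one of the events occurs. -/
lemma ae_exists_mem_of_sum_condProb {ι : Type*} [Fintype ι] (hG : G ≤ m0) {A : ι → Set Ω}
    (hA : ∀ j, MeasurableSet (A j)) (hdisj : Pairwise fun i j => Disjoint (A i) (A j))
    (hsum : ∀ᵐ ω ∂μ, ∑ j, (μ⟦A j | G⟧) ω = 1) : ∀ᵐ ω ∂μ, ∃ j, ω ∈ A j := by
  have h1 : μ.real (⋃ j, A j) = 1 := by
    rw [measureReal_iUnion_fintype hdisj hA]
    calc ∑ j, μ.real (A j) = ∑ j, ∫ ω, (μ⟦A j | G⟧) ω ∂μ := by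
          refine Finset.sum_congr rfl fun j _ => ?_
          rw [integral_condExp hG, integral_indicator_const _ (hA j)]
          simp
      _ = ∫ ω, ∑ j, (μ⟦A j | G⟧) ω ∂μ := (integral_finsetSum _ fun j _ => integrable_condExp).symm
      _ = 1 := by rw [integral_congr_ae hsum]; simp
  have h2 : ∀ᵐ ω ∂μ, ω ∈ ⋃ j, A j := by
    refine (mem_ae_iff_prob_eq_one (MeasurableSet.iUnion hA)).2 ?_
    rwa [measureReal_def, ENNReal.toReal_eq_one_iff] at h1
  filter_upwards [h2] with ω hω using Set.mem_iUnion.1 hω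

end ConditionalExpectation

/-! ### Increments, histories and trajectories of the urn -/

section Urn

lemma measurable_matrix_entry {N : ℕ} (k l : Fin N) :
    Measurable fun A : Matrix (Fin N) (Fin N) ℝ => A k l :=
  (measurable_pi_apply l).comp
    (measurable_pi_apply (X := fun _ : Fin N => Fin N → ℝ) k)

lemma measurable_weight {N : ℕ} : Measurable (weight : (Fin N → ℝ) → ℝ) :=
  Finset.measurable_fun_sum _ fun j _ => measurable_pi_apply j

/-- The `l`-th column of `A` if `x` is the `l`-th unit vector, and zero if `x` is no unit vector. For
unit vectors this is `A *ᵥ x`, but it is bounded by the entries of `A` whatever `x` is, so that a null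
set of irregular draws does not affect integrability. -/
noncomputable def drawnColumn {N : ℕ} (A : Matrix (Fin N) (Fin N) ℝ) (x : Fin N → ℝ)
    (k : Fin N) : ℝ :=
  ∑ l, Set.indicator {Pi.single l (1 : ℝ)} (fun _ => A k l) x

lemma drawnColumn_single {N : ℕ} (A : Matrix (Fin N) (Fin N) ℝ) (j k : Fin N) :
    drawnColumn A (Pi.single j 1) k = A k j := by
  rw [drawnColumn, Finset.sum_eq_single j]
  · simp
  · intro l _ hl
    refine Set.indicator_of_notMem (fun h => hl ?_) _
    by_contra hne
    have := congrFun (Set.mem_singleton_iff.1 h) j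
    simp [Ne.symm hne] at this
  · simp

lemma drawnColumn_single_eq_mulVec {N : ℕ} (A : Matrix (Fin N) (Fin N) ℝ) (j : Fin N) :
    drawnColumn A (Pi.single j 1) = A *ᵥ Pi.single j 1 := by
  ext k
  rw [drawnColumn_single, Matrix.mulVec_single_one, Matrix.col_apply]

variable {Ω : Type*} {N M : ℕ}

section History

variable {C₀ : Ω → Fin N → ℝ} {χ : ℕ → Fin M → Ω → Fin N → ℝ}
  {R : ℕ → Fin M → Ω → Matrix (Fin N) (Fin N) ℝ}

lemma history_mono : Monotone (history C₀ χ R) := by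
  intro m n hmn
  refine sup_le_sup_left (biSup_mono fun j hj => ?_) _
  exact Finset.Icc_subset_Icc_right hmn hj

lemma measurable_initial_history (n : ℕ) : Measurable[history C₀ χ R n] C₀ :=
  measurable_iff_comap_le.2 le_sup_left

lemma comap_sup_comap_le_history (n : ℕ) (i : Fin M) :
    MeasurableSpace.comap (χ (n + 1) i) inferInstance
      ⊔ MeasurableSpace.comap (R (n + 1) i) inferInstance ≤ history C₀ χ R (n + 1) :=
  le_sup_of_le_right (le_iSup₂_of_le (n + 1) (Finset.mem_Icc.2 ⟨by omega, le_rfl⟩)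
    (le_iSup_of_le i le_rfl))

lemma measurable_draw_history (n : ℕ) (i : Fin M) :
    Measurable[history C₀ χ R (n + 1)] (χ (n + 1) i) :=
  measurable_iff_comap_le.2 (le_sup_left.trans (comap_sup_comap_le_history n i))

lemma measurable_replacement_history (n : ℕ) (i : Fin M) :
    Measurable[history C₀ χ R (n + 1)] (R (n + 1) i) :=
  measurable_iff_comap_le.2 (le_sup_right.trans (comap_sup_comap_le_history n i))

variable [m0 : MeasurableSpace Ω]

lemma history_le (hC : Measurable C₀) (hχ : ∀ n i, Measurable (χ (n + 1) i))
    (hR : ∀ n i, Measurable (R (n + 1) i)) (n : ℕ) : history C₀ χ R n ≤ m0 := by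
  refine sup_le hC.comap_le (iSup₂_le fun j hj => iSup_le fun i => ?_)
  obtain ⟨j, rfl⟩ := Nat.exists_eq_add_of_le' (Finset.mem_Icc.1 hj).1
  exact sup_le (hχ j i).comap_le (hR j i).comap_le

/-- The histories of the urn, as a filtration. -/
def historyFiltration (hC : Measurable C₀) (hχ : ∀ n i, Measurable (χ (n + 1) i))
    (hR : ∀ n i, Measurable (R (n + 1) i)) : Filtration ℕ m0 where
  seq := history C₀ χ R
  mono' := history_mono
  le' := history_le hC hχ hR

end History

lemma measurable_drawnColumn {m : MeasurableSpace Ω} {A : Ω → Matrix (Fin N) (Fin N) ℝ}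
    {x : Ω → Fin N → ℝ} (hA : Measurable A) (hx : Measurable x) (k : Fin N) :
    Measurable fun ω => drawnColumn (A ω) (x ω) k := by
  refine Finset.measurable_fun_sum _ fun l _ => ?_
  exact ((measurable_matrix_entry k l).comp hA).indicator (hx (measurableSet_singleton _))

variable {G : MeasurableSpace Ω} [m0 : MeasurableSpace Ω] {μ : Measure Ω}
  [IsProbabilityMeasure μ]

/-- Conditional mean of the replacement caused by one draw: conditional independence of the draw
and the replacement matrix lets the conditional expectation factorize. -/
lemma condExp_drawnColumn (hG : G ≤ m0)
    {A : Ω → Matrix (Fin N) (Fin N) ℝ} {x : Ω → Fin N → ℝ} (hA : Measurable A)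
    (hx : Measurable x) {K : ℝ} (hK : ∀ k l, ∀ᵐ ω ∂μ, ‖A ω k l‖ ≤ K)
    (hind : ∀ S T, MeasurableSet S → MeasurableSet T →
      μ⟦x ⁻¹' S ∩ A ⁻¹' T | G⟧ =ᵐ[μ] μ⟦x ⁻¹' S | G⟧ * μ⟦A ⁻¹' T | G⟧) (k : Fin N) :
    μ[fun ω => drawnColumn (A ω) (x ω) k | G] =ᵐ[μ] fun ω =>
      ∑ l, (μ⟦x ⁻¹' {Pi.single l (1 : ℝ)} | G⟧) ω * (μ[fun ω' => A ω' k l | G]) ω := by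
  have hxm : ∀ l : Fin N, MeasurableSet (x ⁻¹' {Pi.single l (1 : ℝ)}) := fun l =>
    hx (measurableSet_singleton _)
  have hAm : ∀ l, Measurable fun ω => A ω k l := fun l => (measurable_matrix_entry k l).comp hA
  have hsum : (fun ω => drawnColumn (A ω) (x ω) k)
      = ∑ l, (x ⁻¹' {Pi.single l (1 : ℝ)}).indicator fun ω => A ω k l := by
    ext ω
    rw [Finset.sum_apply]
    rfl
  have hfac : ∀ l, μ[(x ⁻¹' {Pi.single l (1 : ℝ)}).indicator (fun ω => A ω k l) | G] =ᵐ[μ]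
      μ⟦x ⁻¹' {Pi.single l (1 : ℝ)} | G⟧ * μ[fun ω' => A ω' k l | G] := fun l => by
    refine condExp_indicator_of_condIndep hG hA.comap_le (hxm l) ?_ ?_ (hK k l)
    · rintro _ ⟨T, hT, rfl⟩
      exact hind _ T (measurableSet_singleton _) hT
    · exact ((measurable_matrix_entry k l).comp (comap_measurable A)).stronglyMeasurable
  rw [hsum]
  refine (condExp_finsetSum (fun l _ => (Integrable.of_bound (hAm l).aestronglyMeasurable K
    (hK k l)).indicator (hxm l)) G).trans ?_
  filter_upwards [ae_all_iff.2 hfac] with ω hω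
  simp only [Finset.sum_apply, hω, Pi.mul_apply]

/-- The series of the steps `1 / (β + n + 1)` diverges. -/
lemma tendsto_sum_one_div_add {β : ℝ} (hβ : 0 < β) :
    Tendsto (fun n => ∑ k ∈ Finset.range n, 1 / (β + (k + 1))) atTop atTop := by
  refine (not_summable_iff_tendsto_nat_atTop_of_nonneg fun n => by positivity).1 fun h => ?_
  refine Real.not_summable_one_div_natCast ((summable_nat_add_iff 1).1 ?_)
  refine Summable.of_nonneg_of_le (fun n => by positivity) (fun n => ?_) (h.mul_left (1 + β))
  have hn : (0 : ℝ) ≤ n := n.cast_nonneg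
  push_cast
  rw [mul_one_div, div_le_div_iff₀ (by positivity) (by positivity)]
  nlinarith

lemma tendsto_one_div_add (β : ℝ) :
    Tendsto (fun n : ℕ => 1 / (β + ((n : ℝ) + 1))) atTop (𝓝 0) := by
  simp only [one_div]
  refine tendsto_inv_atTop_zero.comp (tendsto_atTop_add_const_left _ _ ?_)
  exact tendsto_atTop_add_const_right _ _ tendsto_natCast_atTop_atTop

/-- Along one trajectory the urn is a stochastic approximation scheme with steps
`M γ / s(C (n + 1))`, drift error `(A n - H) X / γ` and noise `ξ n / s(C (n + 1))`, where `Y n` is the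
sum of the columns added in step `n + 1` and `ξ n = Y n - M A n X`. -/
lemma tendsto_urn_trajectory [NeZero N] {H : Matrix (Fin N) (Fin N) ℝ} (hH : H.IsIrreducible)
    {γ : ℝ} (hγ : 0 < γ) (hHsum : ∀ j, ∑ i, H i j = γ) (hM : 0 < M)
    {v : Fin N → ℝ} (hv : ∑ i, v i = 1) (hHv : H *ᵥ v = γ • v)
    {C Y : ℕ → Fin N → ℝ} {A : ℕ → Matrix (Fin N) (Fin N) ℝ}
    (hA : Tendsto A atTop (𝓝 H)) (hAsum : ∀ n j, ∑ i, A n i j = γ)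
    (hC0 : 0 < ∑ i, C 0 i) (hCnn : ∀ n j, 0 ≤ C n j)
    (hCsum : ∀ n, ∑ i, C n i = ∑ i, C 0 i + n * (M * γ))
    (hdyn : ∀ n, C (n + 1) = C n + Y n) {L : Fin N → ℝ}
    (hnoise : ∀ k, Tendsto (fun n => ∑ m ∈ Finset.range n,
      (∑ i, C 0 i + (m + 1) * (M * γ))⁻¹ *
        (Y m k - M * (A m *ᵥ ((∑ i, C m i)⁻¹ • C m)) k)) atTop (𝓝 (L k))) :
    Tendsto (fun n => (∑ i, C n i)⁻¹ • C n) atTop (𝓝 v) := by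
  have hM' : (0 : ℝ) < M := by exact_mod_cast hM
  have hMγ : 0 < M * γ := mul_pos hM' hγ
  set s₀ := ∑ i, C 0 i with hs₀
  have hs : ∀ n, 0 < ∑ i, C n i := fun n => by rw [hCsum]; positivity
  set X : ℕ → Fin N → ℝ := fun n => (∑ i, C n i)⁻¹ • C n with hX
  have hXsum : ∀ n, ∑ i, X n i = 1 := fun n => by
    simp only [hX, Pi.smul_apply, smul_eq_mul, ← Finset.mul_sum]
    exact inv_mul_cancel₀ (hs n).ne'
  have hXnn : ∀ n j, 0 ≤ X n j := fun n j => mul_nonneg (inv_nonneg.2 (hs n).le) (hCnn n j)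
  have hX1 : ∀ n j, ‖X n j‖ ≤ 1 := fun n j => by
    rw [Real.norm_of_nonneg (hXnn n j), ← hXsum n]
    exact Finset.single_le_sum (fun i _ => hXnn n i) (Finset.mem_univ j)
  have hP := inv_smul_mem_colStochastic hH.nonneg hγ hHsum
  have hPirr := isIrreducible_smul hH (inv_pos.2 hγ)
  set δ : ℕ → Fin N → ℝ := fun n => γ⁻¹ • ((A n - H) *ᵥ X n) with hδ
  set ξ : ℕ → Fin N → ℝ := fun n => Y n - (M : ℝ) • (A n *ᵥ X n) with hξ
  refine tendsto_of_stochastic_approximation hP hPirr (a := fun n => 1 / (s₀ / (M * γ) + (n + 1)))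
    (δ := δ) (D := fun n => (s₀ + (n + 1) * (M * γ))⁻¹ • ξ n) (L := L) hv ?_ hXsum ?_ ?_ ?_
    (tendsto_one_div_add _) (tendsto_sum_one_div_add (by positivity)) ?_ ?_
  · rw [Matrix.smul_mulVec, hHv, smul_smul, inv_mul_cancel₀ hγ.ne', one_smul]
  · intro n
    simp only [hδ, Pi.smul_apply, smul_eq_mul, ← Finset.mul_sum, sum_mulVec, Matrix.sub_apply,
      Finset.sum_sub_distrib, hAsum, hHsum, sub_self, zero_mul, Finset.sum_const_zero, mul_zero]
  · refine tendsto_pi_nhds.2 fun k => ?_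
    have hent : ∀ j, Tendsto (fun n => A n k j - H k j) atTop (𝓝 0) := fun j => by
      simpa using (tendsto_pi_nhds.1 (tendsto_pi_nhds.1 hA k) j).sub_const (H k j)
    have hsum : Tendsto (fun n => ∑ j, (A n k j - H k j) * X n j) atTop (𝓝 (∑ _j : Fin N, 0)) := by
      refine tendsto_finsetSum _ fun j _ => ?_
      refine squeeze_zero_norm (fun n => ?_) (tendsto_zero_iff_norm_tendsto_zero.1 (hent j))
      rw [norm_mul]
      exact mul_le_of_le_one_right (norm_nonneg _) (hX1 n j)
    simpa [hδ, Matrix.mulVec, dotProduct] using hsum.const_mul γ⁻¹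
  · intro n
    have : 0 ≤ s₀ / (M * γ) := by positivity
    positivity
  · refine tendsto_pi_nhds.2 fun k => (hnoise k).congr fun n => ?_
    simp only [Finset.sum_apply, Pi.smul_apply, smul_eq_mul, hξ, Pi.sub_apply, hX]
  · intro n
    have hsn := hs n
    have hsn1 := hs (n + 1)
    have hCX : C n = (∑ i, C n i) • X n := by
      simp only [hX, smul_smul, mul_inv_cancel₀ hsn.ne', one_smul]
    have hden : s₀ / (M * γ) + ((n : ℝ) + 1) = (∑ i, C (n + 1) i) / (M * γ) := by
      rw [hCsum]
      field_simp
      push_cast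
      ring
    have hsucc : ∑ i, C (n + 1) i = ∑ i, C n i + M * γ := by
      rw [hCsum, hCsum n]; push_cast; ring
    have hden' : s₀ + ((n : ℝ) + 1) * (M * γ) = ∑ i, C (n + 1) i := by
      rw [hCsum]; push_cast; ring
    have hXsucc : X (n + 1) = (∑ i, C (n + 1) i)⁻¹ • ((∑ i, C n i) • X n + Y n) := by
      rw [← hCX, ← hdyn]
    rw [hXsucc, hden, hden']
    ext k
    simp only [hδ, hξ, Pi.add_apply, Pi.smul_apply, Pi.sub_apply, smul_eq_mul,
      Matrix.smul_mulVec, Matrix.sub_mulVec]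
    have hsn1' := hsn1
    rw [hsucc] at hsn1' ⊢
    field_simp
    ring

end Urn

/-! ### The urn process -/

section UrnProcess

lemma entry_mem_Icc {N : ℕ} {A : Matrix (Fin N) (Fin N) ℝ} {γ : ℝ} (hA : ∀ k l, 0 ≤ A k l)
    (hsum : ∀ j, weight (fun k => A k j) = γ) (k l : Fin N) : 0 ≤ A k l ∧ A k l ≤ γ := by
  refine ⟨hA k l, ?_⟩
  rw [← hsum l]
  exact Finset.single_le_sum (f := fun k => A k l) (fun i _ => hA i l) (Finset.mem_univ k)

lemma weight_mulVec_single {N : ℕ} {A : Matrix (Fin N) (Fin N) ℝ} {γ : ℝ}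
    (hsum : ∀ j, weight (fun k => A k j) = γ) (j : Fin N) :
    weight (A *ᵥ Pi.single j 1) = γ := by
  rw [Matrix.mulVec_single_one, ← hsum j]
  rfl

variable {Ω : Type*} {N M : ℕ} {G : MeasurableSpace Ω} [m0 : MeasurableSpace Ω] {μ : Measure Ω}

/-- Conditional independence of the whole family, restricted to the draw and the replacement matrix
of one trial. -/
lemma CondIndepGiven.pair {x : Fin M → Ω → Fin N → ℝ}
    {A : Fin M → Ω → Matrix (Fin N) (Fin N) ℝ}
    (h : CondIndepGiven μ G
      (Sum.elim (fun i : Fin M => MeasurableSpace.comap (x i) inferInstance)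
        (fun i : Fin M => MeasurableSpace.comap (A i) inferInstance))) (i : Fin M)
    {S : Set (Fin N → ℝ)} {T : Set (Matrix (Fin N) (Fin N) ℝ)} (hS : MeasurableSet S)
    (hT : MeasurableSet T) :
    μ⟦x i ⁻¹' S ∩ A i ⁻¹' T | G⟧ =ᵐ[μ] μ⟦x i ⁻¹' S | G⟧ * μ⟦A i ⁻¹' T | G⟧ := by
  have h2 := h {Sum.inl i, Sum.inr i} (Sum.elim (fun i => x i ⁻¹' S) fun i => A i ⁻¹' T) (by
    rintro (k | k) _
    · exact ⟨S, hS, rfl⟩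
    · exact ⟨T, hT, rfl⟩)
  rw [Finset.prod_pair (by simp)] at h2
  simpa using h2

variable [IsProbabilityMeasure μ] {C : ℕ → Ω → Fin N → ℝ} {χ : ℕ → Fin M → Ω → Fin N → ℝ}
  {R : ℕ → Fin M → Ω → Matrix (Fin N) (Fin N) ℝ} {γ : ℝ}

/-- A draw is almost surely a unit vector once the drawing probabilities add up to one, that is,
once the urn is not empty. -/
lemma ae_exists_eq_single (hG : G ≤ m0) {x c : Ω → Fin N → ℝ} (hx : Measurable x)
    (hc : ∀ᵐ ω ∂μ, 0 < weight (c ω))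
    (hprob : ∀ j, μ⟦x ⁻¹' {Pi.single j (1 : ℝ)} | G⟧ =ᵐ[μ] fun ω => c ω j / weight (c ω)) :
    ∀ᵐ ω ∂μ, ∃ j, x ω = Pi.single j 1 := by
  refine ae_exists_mem_of_sum_condProb (μ := μ) hG (A := fun j => x ⁻¹' {Pi.single j (1 : ℝ)})
    (fun j => hx (measurableSet_singleton _)) (fun i j hij => ?_) ?_
  · refine Disjoint.preimage x (Set.disjoint_singleton.2 fun h => hij ?_)
    by_contra hne
    have := congrFun h i
    simp [hne] at this
  · filter_upwards [ae_all_iff.2 hprob, hc] with ω h1 h2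
    simp only [h1, ← Finset.sum_div]
    exact div_self h2.ne'

/-- Almost surely all compositions are nonnegative with weight `s(C 0) + n M γ`, and all draws
are unit vectors. The two facts need each other: an urn of positive weight draws a unit vector,
which adds a column of weight `γ`. -/
lemma ae_composition_and_draws (hC : Measurable (C 0)) (hχ : ∀ n i, Measurable (χ (n + 1) i))
    (hR : ∀ n i, Measurable (R (n + 1) i))
    (hdyn : ∀ n, ∀ᵐ ω ∂μ, C (n + 1) ω = C n ω + ∑ i, R (n + 1) i ω *ᵥ χ (n + 1) i ω)
    (hinit : ∀ᵐ ω ∂μ, (∀ j, 0 ≤ C 0 ω j) ∧ 0 < weight (C 0 ω))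
    (hdraw : ∀ n i j, μ⟦χ (n + 1) i ⁻¹' {Pi.single j (1 : ℝ)} | history (C 0) χ R n⟧
      =ᵐ[μ] fun ω => C n ω j / weight (C n ω))
    (hnn : ∀ n i, ∀ᵐ ω ∂μ, ∀ k l, 0 ≤ R (n + 1) i ω k l) (hγ : 0 ≤ γ)
    (hsum : ∀ n i, ∀ᵐ ω ∂μ, ∀ j, weight (fun k => R (n + 1) i ω k j) = γ) :
    ∀ᵐ ω ∂μ, ∀ n, ((∀ j, 0 ≤ C n ω j) ∧ weight (C n ω) = weight (C 0 ω) + n * (M * γ)) ∧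
      ∀ i, ∃ j, χ (n + 1) i ω = Pi.single j 1 := by
  have hunit : ∀ n, (∀ᵐ ω ∂μ, weight (C n ω) = weight (C 0 ω) + n * (M * γ)) →
      ∀ᵐ ω ∂μ, ∀ i, ∃ j, χ (n + 1) i ω = Pi.single j 1 := by
    intro n hn
    refine ae_all_iff.2 fun i => ae_exists_eq_single (history_le hC hχ hR n) (hχ n i) ?_ (hdraw n i)
    filter_upwards [hn, hinit] with ω h1 h2
    rw [h1]
    have := h2.2
    positivity
  have hcomp : ∀ n, ∀ᵐ ω ∂μ,
      (∀ j, 0 ≤ C n ω j) ∧ weight (C n ω) = weight (C 0 ω) + n * (M * γ) := by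
    intro n
    induction n with
    | zero => filter_upwards [hinit] with ω h using ⟨h.1, by simp⟩
    | succ n ih =>
      filter_upwards [ih, hunit n (ih.mono fun _ h => h.2), hdyn n, ae_all_iff.2 (hnn n),
        ae_all_iff.2 (hsum n)] with ω h1 h2 h3 h4 h5
      choose j hj using h2
      simp only [hj] at h3
      rw [h3]
      constructor
      · intro k
        simp only [Pi.add_apply, Finset.sum_apply, Matrix.mulVec_single_one, Matrix.col_apply]
        exact add_nonneg (h1.1 k) (Finset.sum_nonneg fun i _ => h4 i k (j i))
      · have hinc : ∑ k, ∑ i, (R (n + 1) i ω *ᵥ Pi.single (j i) 1) k = M * γ := by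
          rw [Finset.sum_comm]
          calc _ = ∑ _i : Fin M, γ :=
                Finset.sum_congr rfl fun i _ => weight_mulVec_single (h5 i) (j i)
            _ = M * γ := by simp
        have hadd : weight (C n ω + ∑ i, R (n + 1) i ω *ᵥ Pi.single (j i) 1)
            = weight (C n ω) + M * γ := by
          rw [← hinc]
          simp only [weight, Pi.add_apply, Finset.sum_apply, Finset.sum_add_distrib]
        rw [hadd, h1.2]
        push_cast
        ring
  exact ae_all_iff.2 fun n => by
    filter_upwards [hcomp n, hunit n ((hcomp n).mono fun _ h => h.2)] with ω h1 h2 using ⟨h1, h2⟩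

lemma condExp_entry_congr (hG : G ≤ m0) {A : Fin M → Ω → Matrix (Fin N) (Fin N) ℝ}
    (hA : ∀ i, Measurable (A i)) {K : ℝ} (hK : ∀ i k l, ∀ᵐ ω ∂μ, ‖A i ω k l‖ ≤ K)
    (hident : CondIdentDistribGiven μ G A) (i i' : Fin M) (k l : Fin N) :
    μ[fun ω => A i ω k l | G] =ᵐ[μ] μ[fun ω => A i' ω k l | G] := by
  have hm : ∀ i, Measurable fun ω => A i ω k l := fun i =>
    (measurable_matrix_entry k l).comp (hA i)
  exact condExp_comp_congr hG (hA i) (hA i') (hident i i') (measurable_matrix_entry k l)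
    (Integrable.of_bound (hm i).aestronglyMeasurable K (hK i k l))
    (Integrable.of_bound (hm i').aestronglyMeasurable K (hK i' k l))

/-- The total increment of one step, with `M` draws, has conditional mean `M H x`, where `H` is
the generating matrix and `x` is the vector of drawing probabilities. -/
lemma condExp_sum_drawnColumn (hG : G ≤ m0) {x : Fin M → Ω → Fin N → ℝ}
    {A : Fin M → Ω → Matrix (Fin N) (Fin N) ℝ} (hx : ∀ i, Measurable (x i))
    (hA : ∀ i, Measurable (A i)) {K : ℝ} (hK : ∀ i k l, ∀ᵐ ω ∂μ, ‖A i ω k l‖ ≤ K)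
    (hident : CondIdentDistribGiven μ G A)
    (hindep : CondIndepGiven μ G
      (Sum.elim (fun i : Fin M => MeasurableSpace.comap (x i) inferInstance)
        (fun i : Fin M => MeasurableSpace.comap (A i) inferInstance)))
    {p : Ω → Fin N → ℝ}
    (hp : ∀ i j, μ⟦x i ⁻¹' {Pi.single j (1 : ℝ)} | G⟧ =ᵐ[μ] fun ω => p ω j)
    (hint : ∀ i k, Integrable (fun ω => drawnColumn (A i ω) (x i ω) k) μ)
    (i₀ : Fin M) (k : Fin N) :
    μ[fun ω => ∑ i, drawnColumn (A i ω) (x i ω) k | G] =ᵐ[μ]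
      fun ω => M * (condExpMatrix μ G (A i₀) ω *ᵥ p ω) k := by
  have hsum : (fun ω => ∑ i, drawnColumn (A i ω) (x i ω) k)
      = ∑ i, fun ω => drawnColumn (A i ω) (x i ω) k := by
    ext ω; rw [Finset.sum_apply]
  rw [hsum]
  refine (condExp_finsetSum (fun i _ => hint i k) G).trans ?_
  have h1 : ∀ i, μ[fun ω => drawnColumn (A i ω) (x i ω) k | G] =ᵐ[μ] fun ω =>
      ∑ l, (μ⟦x i ⁻¹' {Pi.single l (1 : ℝ)} | G⟧) ω * (μ[fun ω' => A i ω' k l | G]) ω := fun i =>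
    condExp_drawnColumn hG (hA i) (hx i) (hK i) (fun S T hS hT => hindep.pair i hS hT) k
  have h2 : ∀ i l, μ[fun ω => A i ω k l | G] =ᵐ[μ] μ[fun ω => A i₀ ω k l | G] := fun i l =>
    condExp_entry_congr hG hA hK hident i i₀ k l
  filter_upwards [ae_all_iff.2 h1, ae_all_iff.2 fun i => ae_all_iff.2 (h2 i),
    ae_all_iff.2 fun i => ae_all_iff.2 (hp i)] with ω h1 h2 h3
  simp only [Finset.sum_apply, h1, h2, h3, condExpMatrix, Matrix.mulVec, dotProduct,
    Matrix.of_apply, Finset.sum_const, Finset.card_univ, Fintype.card_fin, nsmul_eq_mul]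
  congr 1
  exact Finset.sum_congr rfl fun l _ => mul_comm _ _

/-- The conditional expectation of a random matrix inherits constant column sums. -/
lemma ae_weight_condExpMatrix (hG : G ≤ m0) {A : Ω → Matrix (Fin N) (Fin N) ℝ}
    (hA : ∀ k l, Integrable (fun ω => A ω k l) μ)
    (hsum : ∀ᵐ ω ∂μ, ∀ j, weight (fun k => A ω k j) = γ) :
    ∀ᵐ ω ∂μ, ∀ j, weight (fun k => condExpMatrix μ G A ω k j) = γ := by
  refine ae_all_iff.2 fun j => ?_
  have h1 : μ[∑ k, fun ω => A ω k j | G] =ᵐ[μ] ∑ k, μ[fun ω => A ω k j | G] :=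
    condExp_finsetSum (fun k _ => hA k j) G
  have h2 : μ[∑ k, fun ω => A ω k j | G] =ᵐ[μ] fun _ => γ := by
    rw [← condExp_const (μ := μ) hG γ]
    refine condExp_congr_ae ?_
    filter_upwards [hsum] with ω hω
    rw [← hω j, Finset.sum_apply]
    rfl
  filter_upwards [h1, h2] with ω h1 h2
  rw [← h2, h1, Finset.sum_apply]
  rfl

/-- A centered bounded noise, divided by linearly growing weights which are known at time zero,
is almost surely summable. -/
lemma ae_exists_tendsto_sum_noise {ℱ : Filtration ℕ m0} {s : Ω → ℝ} (hs : Measurable[ℱ 0] s)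
    (hs0 : ∀ᵐ ω ∂μ, 0 ≤ s ω) {g : ℝ} (hg : 0 < g) {Y : ℕ → Ω → ℝ} {K : ℝ}
    (hY : ∀ n, Measurable[ℱ (n + 1)] (Y n)) (hK : ∀ n, ∀ᵐ ω ∂μ, ‖Y n ω‖ ≤ K) :
    ∀ᵐ ω ∂μ, ∃ c, Tendsto (fun n => ∑ m ∈ Finset.range n,
      (s ω + (m + 1) * g)⁻¹ * (Y m ω - (μ[Y m | ℱ m]) ω)) atTop (𝓝 c) := by
  have hYint : ∀ n, Integrable (Y n) μ := fun n =>
    Integrable.of_bound ((hY n).mono (ℱ.le _) le_rfl).aestronglyMeasurable K (hK n)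
  have hK' : ∀ n, ∀ᵐ ω ∂μ, ‖(μ[Y n | ℱ n]) ω‖ ≤ K := fun n =>
    ae_bdd_abs_condExp_of_ae_bdd_abs (hK n)
  have hK0 : 0 ≤ K := by
    obtain ⟨ω, hω⟩ := (hK 0).exists
    exact (norm_nonneg _).trans hω
  have ham : ∀ n : ℕ, Measurable[ℱ 0] fun ω => (s ω + (n + 1) * g)⁻¹ := fun n =>
    (hs.add_const _).inv
  have hξint : ∀ n, Integrable (Y n - μ[Y n | ℱ n]) μ := fun n =>
    (hYint n).sub integrable_condExp
  have ha : ∀ n : ℕ, ∀ᵐ ω ∂μ, ‖(s ω + (n + 1) * g)⁻¹‖ ≤ (g * (n + 1))⁻¹ := fun n => by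
    filter_upwards [hs0] with ω hω
    rw [Real.norm_of_nonneg (by positivity)]
    exact inv_anti₀ (by positivity) (by linarith)
  refine ae_exists_tendsto_sum_of_condExp_eq_zero (ℱ := ℱ)
    (b := fun n => (2 * K / g) * ((n : ℝ) + 1)⁻¹) (fun n => ?_) (fun n => ?_) ?_ (fun n => ?_)
  · exact ((ham n).mono (ℱ.mono (Nat.zero_le _)) le_rfl).stronglyMeasurable.mul
      ((hY n).stronglyMeasurable.sub (stronglyMeasurable_condExp.mono (ℱ.mono (Nat.le_succ n))))
  · filter_upwards [ha n, hK n, hK' n] with ω h1 h2 h3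
    rw [← Real.norm_eq_abs, norm_mul]
    calc _ ≤ (g * ((n : ℝ) + 1))⁻¹ * (K + K) :=
          mul_le_mul h1 ((norm_sub_le _ _).trans (add_le_add h2 h3)) (norm_nonneg _)
            (by positivity)
      _ = _ := by rw [mul_inv]; ring
  · have h := (summable_nat_add_iff 1).2 (Real.summable_nat_pow_inv.2 (one_lt_two))
    refine (h.mul_left ((2 * K / g) ^ 2)).congr fun n => ?_
    push_cast
    rw [mul_pow, inv_pow]
  · have hpull := condExp_stronglyMeasurable_mul_of_bound (ℱ.le n)
      ((ham n).mono (ℱ.mono (Nat.zero_le n)) le_rfl).stronglyMeasurable (hξint n) _ (ha n)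
    refine hpull.trans ?_
    have hcen : μ[Y n - μ[Y n | ℱ n] | ℱ n] =ᵐ[μ] 0 := by
      refine (condExp_sub (hYint n) integrable_condExp _).trans ?_
      rw [condExp_of_stronglyMeasurable (ℱ.le n) stronglyMeasurable_condExp integrable_condExp,
        sub_self]
    filter_upwards [hcen] with ω hω
    rw [Pi.mul_apply, hω]
    simp

/-- The normalized leading eigenvectors of an irreducible matrix with column sums `γ` are its
weight-one eigenvectors for `γ`: applying the weight to `H v = ρ v` gives `ρ = γ`. -/
lemma isNormalizedLeadingEigenvector_iff {H : Matrix (Fin N) (Fin N) ℝ}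
    (hH : ∀ i j, 0 ≤ H i j) (hsum : ∀ j, ∑ i, H i j = γ) {v : Fin N → ℝ} :
    IsNormalizedLeadingEigenvector H v ↔ ∑ i, v i = 1 ∧ H *ᵥ v = γ • v := by
  refine ⟨fun ⟨hv, ρ, hρ, _⟩ => ⟨hv, ?_⟩,
    fun ⟨hv, h⟩ => ⟨hv, γ, h, fun z hz => re_le_of_mem_spectrum hH hsum hz⟩⟩
  have h := sum_mulVec H v
  rw [hρ] at h
  simp only [hsum, Pi.smul_apply, smul_eq_mul, ← Finset.mul_sum] at h
  change ∑ i, v i = 1 at hv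
  rw [hv, mul_one, mul_one] at h
  rw [hρ, h]

end UrnProcess

end UrnModel

theorem theorem2 {Ω : Type*} [MeasurableSpace Ω] (μ : Measure Ω) [IsProbabilityMeasure μ]
    (N M : ℕ) (hM : 0 < M)
    -- composition after step `n`; draws and replacement matrices of the steps `1, 2, …`
    (C : ℕ → Ω → Fin N → ℝ)
    (χ : ℕ → Fin M → Ω → Fin N → ℝ)
    (R : ℕ → Fin M → Ω → Matrix (Fin N) (Fin N) ℝ)
    (hC_meas : Measurable (C 0))
    (hχ_meas : ∀ n i, Measurable (χ (n + 1) i))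
    (hR_meas : ∀ n i, Measurable (R (n + 1) i))
    -- dynamics
    (hdyn : ∀ n, ∀ᵐ ω ∂μ, C (n + 1) ω = C n ω + ∑ i, R (n + 1) i ω *ᵥ χ (n + 1) i ω)
    -- (U1)
    (hU1 : ∀ᵐ ω ∂μ, (∀ j, 0 ≤ C 0 ω j) ∧ ∃ j, 0 < C 0 ω j)
    -- (U2)
    (hU2 : ∀ n i j,
      μ⟦χ (n + 1) i ⁻¹' {Pi.single j (1 : ℝ)} | UrnModel.history (C 0) χ R n⟧
        =ᵐ[μ] fun ω => C n ω j / UrnModel.weight (C n ω))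
    -- (U3)
    (hU3_draws : ∀ n,
      UrnModel.CondIdentDistribGiven μ (UrnModel.history (C 0) χ R n) (χ (n + 1)))
    (hU3_repl : ∀ n,
      UrnModel.CondIdentDistribGiven μ (UrnModel.history (C 0) χ R n) (R (n + 1)))
    (hU3_indep : ∀ n,
      UrnModel.CondIndepGiven μ (UrnModel.history (C 0) χ R n)
        (Sum.elim
          (fun i : Fin M => MeasurableSpace.comap (χ (n + 1) i) inferInstance)
          (fun i : Fin M => MeasurableSpace.comap (R (n + 1) i) inferInstance)))
    -- (U4)
    (hU4 : ∀ n i, ∀ᵐ ω ∂μ, ∀ k l, 0 ≤ R (n + 1) i ω k l)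
    -- (U5)
    (γ₁ : ℝ)
    (hU5 : ∀ n i, ∀ᵐ ω ∂μ, ∀ j, UrnModel.weight (fun k => R (n + 1) i ω k j) = γ₁)
    -- the generating matrices: `Hgen n` belongs to step `n + 1`
    (Hgen : ℕ → Ω → Matrix (Fin N) (Fin N) ℝ)
    (hHgen : ∀ n, Hgen n =
      UrnModel.condExpMatrix μ (UrnModel.history (C 0) χ R n) (R (n + 1) ⟨0, hM⟩))
    -- (U6)
    (γ₂ : ℝ)
    (hU6 : ∀ n, ∀ᵐ ω ∂μ, ∀ j, UrnModel.weight (fun k => Hgen n ω k j) = γ₂)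
    -- (U7)
    (H : Matrix (Fin N) (Fin N) ℝ) (hH : H.IsIrreducible)
    (hU7 : ∀ᵐ ω ∂μ, Tendsto (fun n => Hgen n ω) atTop (𝓝 H)) :
    (∃! v : Fin N → ℝ, UrnModel.IsNormalizedLeadingEigenvector H v) ∧
      ∀ v : Fin N → ℝ, UrnModel.IsNormalizedLeadingEigenvector H v →
        ∀ᵐ ω ∂μ, Tendsto (fun n => (UrnModel.weight (C n ω))⁻¹ • C n ω) atTop (𝓝 v) := by
  have hN : NeZero N := by
    obtain ⟨ω, -, j, -⟩ := hU1.exists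
    exact ⟨(Fin.pos j).ne'⟩
  have hG := UrnModel.history_le hC_meas hχ_meas hR_meas
  have hent : ∀ n i, ∀ᵐ ω ∂μ, ∀ k l, 0 ≤ R (n + 1) i ω k l ∧ R (n + 1) i ω k l ≤ γ₁ := fun n i => by
    filter_upwards [hU4 n i, hU5 n i] with ω h1 h2 using UrnModel.entry_mem_Icc h1 h2
  have hR_norm : ∀ n i k l, ∀ᵐ ω ∂μ, ‖R (n + 1) i ω k l‖ ≤ γ₁ := fun n i k l => by
    filter_upwards [hent n i] with ω h
    rw [Real.norm_of_nonneg (h k l).1]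
    exact (h k l).2
  have hR_int : ∀ n i k l, Integrable (fun ω => R (n + 1) i ω k l) μ := fun n i k l =>
    Integrable.of_bound
      ((UrnModel.measurable_matrix_entry k l).comp (hR_meas n i)).aestronglyMeasurable γ₁
      (hR_norm n i k l)
  -- the limit matrix inherits the column sums `γ₁`
  have hHgen_sum : ∀ n, ∀ᵐ ω ∂μ, ∀ j, UrnModel.weight (fun k => Hgen n ω k j) = γ₁ := fun n => by
    rw [hHgen n]
    exact UrnModel.ae_weight_condExpMatrix (hG n) (hR_int n _) (hU5 n _)
  have hH_sum : ∀ j, ∑ i, H i j = γ₁ := by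
    obtain ⟨ω, h1, h2⟩ := ((ae_all_iff.2 hHgen_sum).and hU7).exists
    intro j
    refine tendsto_nhds_unique (tendsto_finsetSum Finset.univ fun i _ =>
      tendsto_pi_nhds.1 (tendsto_pi_nhds.1 h2 i) j) ?_
    have hconst : ∀ n, ∑ i, Hgen n ω i j = γ₁ := fun n => h1 n j
    simp only [hconst]
    exact tendsto_const_nhds
  have hγ : 0 < γ₁ := UrnModel.pos_of_isIrreducible_of_sum_eq hH hH_sum
  have hlead : ∀ v, UrnModel.IsNormalizedLeadingEigenvector H v ↔
      ∑ i, v i = 1 ∧ H *ᵥ v = γ₁ • v := fun v =>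
    UrnModel.isNormalizedLeadingEigenvector_iff hH.nonneg hH_sum
  simp only [hlead]
  have hfix : ∀ v, H *ᵥ v = γ₁ • v ↔ (γ₁⁻¹ • H) *ᵥ v = v := fun v => by
    rw [Matrix.smul_mulVec, inv_smul_eq_iff₀ hγ.ne']
  have hP := UrnModel.inv_smul_mem_colStochastic hH.nonneg hγ hH_sum
  have hPirr := UrnModel.isIrreducible_smul hH (inv_pos.2 hγ)
  refine ⟨?_, fun v ⟨hv, hHv⟩ => ?_⟩
  · obtain ⟨v, hv, hPv⟩ := UrnModel.exists_fixed_vector hP hPirr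
    refine ⟨v, ⟨hv, (hfix v).2 hPv⟩, fun w ⟨hw, hHw⟩ => ?_⟩
    refine sub_eq_zero.1 (UrnModel.eq_zero_of_mulVec_eq_self hP hPirr (y := w - v) ?_ ?_)
    · simp [Finset.sum_sub_distrib, hv, hw]
    · rw [Matrix.mulVec_sub, (hfix w).1 hHw, hPv]
  have hinit : ∀ᵐ ω ∂μ, (∀ j, 0 ≤ C 0 ω j) ∧ 0 < UrnModel.weight (C 0 ω) := by
    filter_upwards [hU1] with ω ⟨h1, j, hj⟩
    exact ⟨h1, Finset.sum_pos' (fun i _ => h1 i) ⟨j, Finset.mem_univ j, hj⟩⟩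
  have hstate := UrnModel.ae_composition_and_draws hC_meas hχ_meas hR_meas hdyn hinit hU2 hU4
    hγ.le hU5
  set ℱ := UrnModel.historyFiltration hC_meas hχ_meas hR_meas
  -- the increment of step `n + 1`, written with the columns of the drawn colours
  set Y : ℕ → Fin N → Ω → ℝ := fun n k ω =>
    ∑ i, UrnModel.drawnColumn (R (n + 1) i ω) (χ (n + 1) i ω) k with hY
  have hcol_norm : ∀ n i k, ∀ᵐ ω ∂μ,
      ‖UrnModel.drawnColumn (R (n + 1) i ω) (χ (n + 1) i ω) k‖ ≤ γ₁ := fun n i k => by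
    filter_upwards [hstate, hent n i] with ω h1 h2
    obtain ⟨j, hj⟩ := (h1 n).2 i
    rw [hj, UrnModel.drawnColumn_single, Real.norm_of_nonneg (h2 k j).1]
    exact (h2 k j).2
  have hcol_int : ∀ n i k,
      Integrable (fun ω => UrnModel.drawnColumn (R (n + 1) i ω) (χ (n + 1) i ω) k) μ :=
    fun n i k => Integrable.of_bound (UrnModel.measurable_drawnColumn (hR_meas n i) (hχ_meas n i)
      k).aestronglyMeasurable γ₁ (hcol_norm n i k)
  have hY_meas : ∀ n k, Measurable[ℱ (n + 1)] (Y n k) := fun n k =>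
    Finset.measurable_fun_sum _ fun i _ => UrnModel.measurable_drawnColumn
      (UrnModel.measurable_replacement_history n i) (UrnModel.measurable_draw_history n i) k
  have hY_norm : ∀ n k, ∀ᵐ ω ∂μ, ‖Y n k ω‖ ≤ M * γ₁ := fun n k => by
    filter_upwards [ae_all_iff.2 fun i => hcol_norm n i k] with ω h
    refine (norm_sum_le _ _).trans ((Finset.sum_le_sum fun i _ => h i).trans (le_of_eq ?_))
    simp
  have hY_mean : ∀ n k, μ[Y n k | ℱ n] =ᵐ[μ] fun ω =>
      M * (Hgen n ω *ᵥ ((UrnModel.weight (C n ω))⁻¹ • C n ω)) k := fun n k => by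
    rw [hHgen n]
    refine UrnModel.condExp_sum_drawnColumn (hG n) (hχ_meas n) (hR_meas n) (hR_norm n)
      (hU3_repl n) (hU3_indep n) (fun i j => (hU2 n i j).trans (ae_of_all _ fun ω => ?_))
      (hcol_int n) ⟨0, hM⟩ k
    simp only [Pi.smul_apply, smul_eq_mul]
    exact div_eq_inv_mul _ _
  have hM' : (0 : ℝ) < M := by exact_mod_cast hM
  have hnoise : ∀ k, ∀ᵐ ω ∂μ, ∃ c, Tendsto (fun n => ∑ m ∈ Finset.range n,
      (UrnModel.weight (C 0 ω) + (m + 1) * (M * γ₁))⁻¹ * (Y m k ω - (μ[Y m k | ℱ m]) ω))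
      atTop (𝓝 c) := fun k =>
    UrnModel.ae_exists_tendsto_sum_noise (s := fun ω => UrnModel.weight (C 0 ω))
      (UrnModel.measurable_weight.comp (UrnModel.measurable_initial_history 0))
      (hinit.mono fun ω h => h.2.le) (mul_pos hM' hγ) (fun n => hY_meas n k) (fun n => hY_norm n k)
  filter_upwards [hstate, hinit, ae_all_iff.2 hdyn, hU7, ae_all_iff.2 hHgen_sum,
    ae_all_iff.2 fun n => ae_all_iff.2 (hY_mean n), ae_all_iff.2 hnoise]
    with ω hstate hinit hdyn hU7 hHgen_sum hY_mean hnoise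
  choose L hL using hnoise
  refine UrnModel.tendsto_urn_trajectory hH hγ hH_sum hM hv hHv (C := fun n => C n ω)
    (Y := fun n k => Y n k ω) hU7 hHgen_sum hinit.2 (fun n => (hstate n).1.1)
    (fun n => (hstate n).1.2) (fun n => ?_) (L := L) (fun k => ?_)
  · rw [hdyn n]
    congr 1
    ext k
    rw [Finset.sum_apply]
    refine Finset.sum_congr rfl fun i _ => ?_
    obtain ⟨j, hj⟩ := (hstate n).2 i
    rw [hj, UrnModel.drawnColumn_single_eq_mulVec]
  · refine (hL k).congr fun n => Finset.sum_congr rfl fun m _ => ?_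
    rw [hY_mean]
    rfl
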